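/- Let $M$ be a smooth real supermanifold of dimension $(p|q)$ with structure sheaf $\mathscr{C}^\infty_M$, and use the Cartan calculus with Deligne's sign convention: $d$ has form degree $1$ and is even, $i_X$ has form degree $-1$ and the parity of $X$, $i_{fX}=f\,i_X$, and $i_X i_Y=-(-1)^{|X||Y|}i_Y i_X$ for $X,Y$ of parities $|X|,|Y|$. Let $\alpha$ be a differential $k$-form on $M$, $k\ge 0$ (not necessarily of definite parity), and for every open $U$ in the body of $M$ let $$\chi(\alpha)(U)=\{X \text{ a vector field on } U:\ i_X\alpha=0 \text{ and } i_X d\alpha=0\},$$ that is, $\chi(\alpha)=\ker\alpha\cap\ker d\alpha$ (with $i_X=0$ on $0$-forms). Suppose that $\alpha$ is regular, i.e. that for some $r$, $\chi(\alpha)$ is a distribution of rank $r$: a vector subbundle of $\mathsf{T}M$ of total rank $r$, which means that near every point of the body there is a local frame of $\mathsf{T}M$ consisting of homogeneous (even or odd) vector fields such that $r$ of them freely generate $\chi(\alpha)$ as a left $\mathscr{C}^\infty_M$-module. Then: 1. $\chi(\alpha)$ is involutive: for every open $U$ and all $X,Y\in\chi(\alpha)(U)$, the super Lie bracket $[X,Y]$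 lies in $\chi(\alpha)(U)$; 2. $\alpha$ is $\chi(\alpha)$-invariant: $\mathcal{L}_X\alpha=0$ on $U$ for every open $U$ and every $X\in\chi(\alpha)(U)$. -/

import Mathlib

open CategoryTheory TopologicalSpace Opposite
open scoped Manifold ContDiff TensorProduct

universe u

noncomputable section

/-- The Koszul sign `(-1)^a` of a parity `a`. -/
def koszulSign (a : ZMod 2) : ℝ := (-1) ^ a.val

/-- Superfunctions on the superdomain of dimension `p|q` with underlying open set `W ⊆ ℝ^p`:
the algebra `C^∞(W) ⊗ Λ(ℝ^q)`. -/
abbrev SuperDomain (p q : ℕ) (W : Opens (EuclideanSpace ℝ (Fin p))) : Type :=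
  C^∞⟮𝓘(ℝ, EuclideanSpace ℝ (Fin p)), W; 𝓘(ℝ, ℝ), ℝ⟯ ⊗[ℝ] ExteriorAlgebra ℝ (Fin q → ℝ)

/-- The open set `φ⁻¹(W)` in the source of a chart `φ`. -/
def chartPreimage {X E : Type*} [TopologicalSpace X] [TopologicalSpace E]
    (φ : OpenPartialHomeomorph X E) (W : Opens E) : Opens X :=
  ⟨φ.source ∩ φ ⁻¹' W, φ.isOpen_inter_preimage W.isOpen⟩

theorem chartPreimage_mono {X E : Type*} [TopologicalSpace X] [TopologicalSpace E]
    (φ : OpenPartialHomeomorph X E) {W' W : Opens E} (h : W' ≤ W) :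
    chartPreimage φ W' ≤ chartPreimage φ W :=
  fun _ hx => ⟨hx.1, h hx.2⟩

/-- A (smooth, real) supermanifold of dimension `p|q`: a second countable Hausdorff space (the body)
with a sheaf of supercommutative `ℝ`-algebras that is locally isomorphic, as a sheaf of
`ℤ/2`-graded algebras, to `C^∞ ⊗ Λ(ℝ^q)` over open subsets of `ℝ^p`. -/
structure Supermanifold (p q : ℕ) where
  /-- The underlying space of the body. -/
  body : TopCat.{u}
  t2 : T2Space body
  secondCountable : SecondCountableTopology body
  /-- The sheaf of superfunctions. -/
  structureSheaf : TopCat.Sheaf (AlgCat.{u} ℝ) body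
  /-- Superfunctions of given parity. -/
  parity : ∀ U : Opens body, ZMod 2 → Submodule ℝ (structureSheaf.presheaf.obj (op U))
  graded : ∀ U, GradedAlgebra (parity U)
  parity_res : ∀ {V U : Opens body} (h : V ≤ U) {a : ZMod 2}
    {f : structureSheaf.presheaf.obj (op U)}, f ∈ parity U a →
      (structureSheaf.presheaf.map (homOfLE h).op).hom f ∈ parity V a
  supercomm : ∀ {U : Opens body} {a b : ZMod 2} {f g : structureSheaf.presheaf.obj (op U)},
    f ∈ parity U a → g ∈ parity U b → f * g = koszulSign (a * b) • (g * f)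
  exists_chart : ∀ x : body, ∃ φ : OpenPartialHomeomorph body (EuclideanSpace ℝ (Fin p)),
    x ∈ φ.source ∧
    ∃ e : ∀ W : Opens (EuclideanSpace ℝ (Fin p)), (W : Set _) ⊆ φ.target →
        (SuperDomain p q W ≃ₐ[ℝ] structureSheaf.presheaf.obj (op (chartPreimage φ W))),
      (∀ W hW g, ∀ a : ZMod 2, ∀ l ∈ CliffordAlgebra.evenOdd (0 : QuadraticForm ℝ (Fin q → ℝ)) a,
        e W hW (g ⊗ₜ[ℝ] l) ∈ parity (chartPreimage φ W) a) ∧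
      (∀ W hW W' hW', ∀ h : W' ≤ W, ∀ g l,
        (structureSheaf.presheaf.map (homOfLE (chartPreimage_mono φ h)).op).hom
            (e W hW (g ⊗ₜ[ℝ] l)) =
          e W' hW' (ContMDiffMap.restrictRingHom 𝓘(ℝ, EuclideanSpace ℝ (Fin p)) 𝓘(ℝ, ℝ) ℝ h g
            ⊗ₜ[ℝ] l))

namespace Supermanifold

attribute [instance] t2 secondCountable graded

variable {p q : ℕ} (M : Supermanifold.{u} p q)

/-- The algebra of superfunctions over an open subset of the body. -/
abbrev Fn (U : Opens M.body) : Type u := M.structureSheaf.presheaf.obj (op U)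

/-- Restriction of superfunctions. -/
def res {V U : Opens M.body} (h : V ≤ U) : M.Fn U →ₐ[ℝ] M.Fn V :=
  (M.structureSheaf.presheaf.map (homOfLE h).op).hom

theorem res_res {W V U : Opens M.body} (h : W ≤ V) (h' : V ≤ U) (f : M.Fn U) :
    M.res h (M.res h' f) = M.res (h.trans h') f := by
  have : (homOfLE (h.trans h')).op = (homOfLE h').op ≫ (homOfLE h).op := rfl
  simp [res, this]

/-- Families of `ℝ`-linear endomorphisms of the spaces of superfunctions over the open subsets
of `U`. -/
abbrev Oper (U : Opens M.body) : Type u := ∀ V : {V // V ≤ U}, Module.End ℝ (M.Fn V.1)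

/-- Homogeneous vector fields of parity `a` on `U`: superderivations of parity `a` of the
structure sheaf over `U`. -/
def homVec (U : Opens M.body) (a : ZMod 2) : Submodule ℝ (M.Oper U) where
  carrier := {D |
    (∀ (V W : {V // V ≤ U}) (h : W.1 ≤ V.1) (f : M.Fn V.1), M.res h (D V f) = D W (M.res h f)) ∧
    (∀ (V : {V // V ≤ U}) (b : ZMod 2) (f : M.Fn V.1), f ∈ M.parity V.1 b →
      D V f ∈ M.parity V.1 (a + b)) ∧
    (∀ (V : {V // V ≤ U}) (b : ZMod 2) (f g : M.Fn V.1), f ∈ M.parity V.1 b →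
      D V (f * g) = D V f * g + koszulSign (a * b) • (f * D V g))}
  add_mem' := by
    rintro D E ⟨h1, h2, h3⟩ ⟨k1, k2, k3⟩
    refine ⟨fun V W h f => ?_, fun V b f hf => ?_, fun V b f g hf => ?_⟩
    · simp [h1 V W h, k1 V W h]
    · exact add_mem (h2 V b f hf) (k2 V b f hf)
    · simp only [Pi.add_apply, LinearMap.add_apply, h3 V b f g hf, k3 V b f g hf, mul_add, add_mul,
        smul_add]
      abel
  zero_mem' := by
    refine ⟨fun V W h f => ?_, fun V b f hf => ?_, fun V b f g hf => ?_⟩ <;> simp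
  smul_mem' := by
    rintro c D ⟨h1, h2, h3⟩
    refine ⟨fun V W h f => ?_, fun V b f hf => ?_, fun V b f g hf => ?_⟩
    · simp [h1 V W h]
    · exact Submodule.smul_mem _ c (h2 V b f hf)
    · simp only [Pi.smul_apply, LinearMap.smul_apply, h3 V b f g hf, smul_add, smul_mul_assoc,
        mul_smul_comm]
      rw [smul_comm]

/-- Vector fields on `U`, as pairs of an even and an odd part. -/
abbrev Vec (U : Opens M.body) : Type u := ∀ a : ZMod 2, M.homVec U a

variable {M} {U V W : Opens M.body}

/-- A homogeneous vector field, as a vector field. -/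
def Vec.of {a : ZMod 2} (X : M.homVec U a) : M.Vec U := Pi.single a X

/-- The homogeneous component of parity `a`, as a vector field. -/
def Vec.part (X : M.Vec U) (a : ZMod 2) : M.Vec U := Vec.of (X a)

/-- `X` is homogeneous of parity `a`. -/
def Vec.IsHom (X : M.Vec U) (a : ZMod 2) : Prop := X = X.part a

/-- The operator on superfunctions given by a vector field: the sum of those given by its even and
its odd part. -/
def Vec.oper (X : M.Vec U) : M.Oper U := ∑ a, (X a : M.Oper U)

/-- The action of a vector field on superfunctions. -/
def Vec.app (X : M.Vec U) (f : M.Fn U) : M.Fn U := X.oper ⟨U, le_rfl⟩ f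

/-- Restriction of vector fields to a smaller open set. -/
def Vec.restrict (h : V ≤ U) (X : M.Vec U) : M.Vec V := fun a =>
  ⟨fun W => (X a : M.Oper U) ⟨W.1, W.2.trans h⟩,
    fun W W' k f => (X a).2.1 ⟨W.1, W.2.trans h⟩ ⟨W'.1, W'.2.trans h⟩ k f,
    fun W => (X a).2.2.1 ⟨W.1, W.2.trans h⟩, fun W => (X a).2.2.2 ⟨W.1, W.2.trans h⟩⟩

/-- Left multiplication by a superfunction. -/
def mulOper (U : Opens M.body) : M.Fn U →+* M.Oper U where
  toFun f := fun V => LinearMap.mulLeft ℝ (M.res V.2 f)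
  map_one' := by ext; simp
  map_mul' f g := by ext; simp
  map_zero' := by ext; simp
  map_add' f g := by ext; simp [add_mul]

theorem koszulSign_add (a b : ZMod 2) : koszulSign (a + b) = koszulSign a * koszulSign b := by
  have h : ∀ a b : ZMod 2, (-1 : ℤ) ^ (a + b).val = (-1) ^ a.val * (-1) ^ b.val := by decide
  simpa [koszulSign] using congrArg (Int.cast : ℤ → ℝ) (h a b)

theorem mulOper_mem {a b c : ZMod 2} (hc : b + a = c) {f : M.Fn U} (hf : f ∈ M.parity U b)
    {D : M.Oper U} (hD : D ∈ M.homVec U a) : mulOper U f * D ∈ M.homVec U c := by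
  subst hc
  obtain ⟨h1, h2, h3⟩ := hD
  refine ⟨fun V W h g => ?_, fun V d g hg => ?_, fun V d g g' hg => ?_⟩
  · change M.res h (M.res V.2 f * D V g) = M.res W.2 f * D W (M.res h g)
    rw [map_mul, h1 V W h, res_res]
  · rw [add_assoc]
    exact SetLike.mul_mem_graded (M.parity_res _ hf) (h2 V d g hg)
  · have hs := M.supercomm (M.parity_res V.2 hf) hg
    change M.res V.2 f * g = koszulSign (b * d) • (g * M.res V.2 f) at hs
    have hk : koszulSign (b * d) * koszulSign (b * d) = 1 := by
      rw [← koszulSign_add, CharTwo.add_self_eq_zero]; simp [koszulSign]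
    change M.res V.2 f * D V (g * g') = M.res V.2 f * D V g * g' +
      koszulSign ((b + a) * d) • (g * (M.res V.2 f * D V g'))
    rw [h3 V d g g' hg, mul_add, add_mul b a d, koszulSign_add, mul_smul_comm, ← mul_assoc,
      ← mul_assoc, hs, smul_mul_assoc, smul_smul, mul_comm (koszulSign (a * d)), mul_assoc,
      mul_assoc]

/-- Left multiplication of a vector field by a superfunction, `(f X)(g) = f X(g)`, written out in
homogeneous components. -/
instance : SMul (M.Fn U) (M.Vec U) where
  smul f X := fun c => ⟨∑ a, mulOper U (GradedRing.proj (M.parity U) (c - a) f) * (X a : M.Oper U),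
    Submodule.sum_mem _ fun a _ => mulOper_mem (sub_add_cancel c a)
      (by rw [GradedRing.proj_apply]; exact SetLike.coe_mem _) (X a).2⟩

theorem sum_proj (f : M.Fn U) : ∑ c, GradedRing.proj (M.parity U) c f = f := by
  classical
  conv_rhs => rw [← DirectSum.sum_support_decompose (M.parity U) f]
  refine (Finset.sum_subset (Finset.subset_univ _) fun i _ hi => ?_).symm
  simpa using hi

theorem Vec.oper_smul (f : M.Fn U) (X : M.Vec U) : (f • X).oper = mulOper U f * X.oper := by
  change ∑ c, ∑ a, mulOper U (GradedRing.proj (M.parity U) (c - a) f) * (X a : M.Oper U) = _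
  rw [Finset.sum_comm, Vec.oper, Finset.mul_sum]
  refine Finset.sum_congr rfl fun a _ => ?_
  rw [← Finset.sum_mul, ← map_sum]
  congr 2
  rw [← Equiv.sum_comp (Equiv.addRight a)]
  simpa using sum_proj f

/-- `Vec.oper` as an additive map. -/
def Vec.operHom (U : Opens M.body) : M.Vec U →+ M.Oper U where
  toFun := Vec.oper
  map_zero' := by simp [Vec.oper]
  map_add' X Y := by simp [Vec.oper, Finset.sum_add_distrib]

theorem Vec.operHom_injective (U : Opens M.body) : Function.Injective (Vec.operHom (M := M) U) := by
  rw [injective_iff_map_eq_zero]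
  intro X hX
  funext a
  refine Subtype.ext (funext fun V => LinearMap.ext fun f => ?_)
  have key : ∀ b, (X a : M.Oper U) V (GradedRing.proj (M.parity V.1) b f) = 0 := by
    intro b
    have hb : GradedRing.proj (M.parity V.1) b f ∈ M.parity V.1 b := by
      rw [GradedRing.proj_apply]; exact SetLike.coe_mem _
    set g := GradedRing.proj (M.parity V.1) b f
    have h0 : ∑ c, (X c : M.Oper U) V g = 0 := by
      have := congrArg (fun D : M.Oper U => D V g) hX
      change (∑ c, (X c : M.Oper U)) V g = 0 at this
      simpa using this
    have h1 := congrArg (GradedRing.proj (M.parity V.1) (a + b)) h0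
    rw [map_sum, Finset.sum_eq_single a] at h1
    · rw [GradedRing.proj_apply, DirectSum.decompose_of_mem_same _ ((X a).2.2.1 V b g hb)] at h1
      simpa using h1
    · intro c _ hc
      rw [GradedRing.proj_apply, DirectSum.decompose_of_mem_ne _ ((X c).2.2.1 V b g hb)]
      simpa using hc
    · simp
  rw [← sum_proj f, map_sum, Finset.sum_eq_zero fun b _ => key b]
  simp

/-- Vector fields on `U` form a left module over the superfunctions on `U`. -/
instance : Module (M.Fn U) (M.Vec U) :=
  letI : Module (M.Fn U) (M.Oper U) := Module.compHom _ (mulOper U)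
  Function.Injective.module (M.Fn U) (Vec.operHom U) (Vec.operHom_injective U) Vec.oper_smul

theorem bracket_mem {a b c : ZMod 2} (hc : a + b = c) {D E : M.Oper U} (hD : D ∈ M.homVec U a)
    (hE : E ∈ M.homVec U b) : D * E - koszulSign (a * b) • (E * D) ∈ M.homVec U c := by
  subst hc
  obtain ⟨h1, h2, h3⟩ := hD
  obtain ⟨k1, k2, k3⟩ := hE
  refine ⟨fun V W h g => ?_, fun V d g hg => ?_, fun V d g g' hg => ?_⟩
  · simp [h1 V W h, k1 V W h]
  · refine sub_mem ?_ (Submodule.smul_mem _ _ ?_)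
    · rw [add_assoc]; exact h2 V _ _ (k2 V _ _ hg)
    · rw [add_comm a b, add_assoc]; exact k2 V _ _ (h2 V _ _ hg)
  · have hk : koszulSign (a * b) * koszulSign (a * b) = 1 := by
      rw [← koszulSign_add, CharTwo.add_self_eq_zero]; simp [koszulSign]
    change D V (E V (g * g')) - koszulSign (a * b) • E V (D V (g * g')) =
      (D V (E V g) - koszulSign (a * b) • E V (D V g)) * g' + koszulSign ((a + b) * d) •
        (g * (D V (E V g') - koszulSign (a * b) • E V (D V g')))
    rw [k3 V d g g' hg, h3 V d g g' hg, map_add, map_add, map_smul, map_smul,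
      h3 V _ _ _ (k2 V d g hg), h3 V d g _ hg, k3 V _ _ _ (h2 V d g hg), k3 V d g _ hg,
      add_mul a b d, mul_add a b d, mul_add b a d, koszulSign_add, koszulSign_add, koszulSign_add,
      mul_comm b a]
    simp only [sub_mul, mul_sub, smul_sub, smul_add, smul_smul, smul_mul_assoc, mul_smul_comm]
    rw [← mul_assoc (koszulSign (a * b)) (koszulSign (a * b)) (koszulSign (b * d)), hk, one_mul]
    module

/-- The super Lie bracket: the bilinear extension of `[X, Y] = X Y - (-1)^{|X||Y|} Y X` for
homogeneous `X`, `Y`. -/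
instance : Bracket (M.Vec U) (M.Vec U) where
  bracket X Y := fun c => ⟨∑ a, ((X a : M.Oper U) * (Y (c - a) : M.Oper U) -
      koszulSign (a * (c - a)) • ((Y (c - a) : M.Oper U) * (X a : M.Oper U))),
    Submodule.sum_mem _ fun a _ => bracket_mem (add_sub_cancel a c) (X a).2 (Y (c - a)).2⟩

variable (M) in
/-- `k`-cochains on `U`: functions that send `k` vector fields on an open `V ⊆ U` to a superfunction
on `V`. Differential forms are the superalternating multilinear natural ones; a `k`-form `η` is
identified with `(X₁, …, X_k) ↦ i_{X_k} ⋯ i_{X₁} η`. -/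
abbrev Cochain (U : Opens M.body) (k : ℕ) : Type u :=
  ∀ V : {V // V ≤ U}, (Fin k → M.Vec V.1) → M.Fn V.1

/-- Restriction of cochains to a smaller open set. -/
def Cochain.restrict {k : ℕ} (h : V ≤ U) (η : M.Cochain U k) : M.Cochain V k :=
  fun W => η ⟨W.1, W.2.trans h⟩

/-- Differential `k`-forms on `U`, with the sign rules `i_{fX} = f i_X`,
`i_Y f = (-1)^{|Y||f|} f i_Y` and `i_Y i_X = -(-1)^{|X||Y|} i_X i_Y` for homogeneous `f`, `X`, `Y`
(Deligne's convention). -/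
structure IsForm {k : ℕ} (η : M.Cochain U k) : Prop where
  natural : ∀ (V W : {V // V ≤ U}) (h : W.1 ≤ V.1) (X : Fin k → M.Vec V.1),
    M.res h (η V X) = η W fun i => (X i).restrict h
  map_add : ∀ (V : {V // V ≤ U}) (X : Fin k → M.Vec V.1) (i : Fin k) (Y Z : M.Vec V.1),
    η V (Function.update X i (Y + Z)) =
      η V (Function.update X i Y) + η V (Function.update X i Z)
  map_smul : ∀ (V : {V // V ≤ U}) (X : Fin k → M.Vec V.1) (s : Fin k → ZMod 2) (i : Fin k)
    (b : ZMod 2) (f : M.Fn V.1), (∀ j, (X j).IsHom (s j)) → f ∈ M.parity V.1 b →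
    η V (Function.update X i (f • X i)) =
      koszulSign (b * ∑ l ∈ Finset.Ioi i, s l) • (f * η V X)
  map_swap : ∀ (V : {V // V ≤ U}) (X : Fin k → M.Vec V.1) (s : Fin k → ZMod 2) (i j : Fin k),
    (∀ l, (X l).IsHom (s l)) → (i : ℕ) + 1 = j →
    η V (X ∘ Equiv.swap i j) = -(koszulSign (s i * s j) • η V X)

/-- The interior product `i_X`, the insertion of `X` in the first slot; it is zero on `0`-forms. -/
def interior (X : M.Vec U) : {k : ℕ} → M.Cochain U k → M.Cochain U (k - 1)
  | 0, _ => 0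
  | _ + 1, η => fun V Y => η V (Fin.cons (X.restrict V.2) Y)

/-- The Lie derivative `L_X`. For homogeneous `X` and `Y₁, …, Y_k` of parities `a` and `s₁, …, s_k`,
`(L_X η)(Y₁, …, Y_k) = (-1)^{a (s₁ + ⋯ + s_k)} X(η(Y₁, …, Y_k))
  - ∑_j (-1)^{a (s₁ + ⋯ + s_j)} η(Y₁, …, [X, Y_j], …, Y_k)`,
extended to all vector fields by summing over homogeneous components. -/
def lieDerivative {k : ℕ} (X : M.Vec U) (η : M.Cochain U k) : M.Cochain U k := fun V Y =>
  ∑ a : ZMod 2, ∑ s : Fin k → ZMod 2,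
    (koszulSign (a * ∑ l, s l) •
        ((X.restrict V.2).part a).app (η V fun i => (Y i).part (s i)) -
      ∑ j, koszulSign (a * ∑ l ∈ Finset.Iic j, s l) •
        η V (Function.update (fun i => (Y i).part (s i)) j
          ⁅(X.restrict V.2).part a, (Y j).part (s j)⁆))

/-- The exterior derivative, by the Koszul formula. For homogeneous `X₀, …, X_k` of parities
`s₀, …, s_k`,
`(dη)(X₀, …, X_k) = ∑_i (-1)^i (-1)^{s_i (s_{i+1} + ⋯ + s_k)} X_i(η(X₀, …, X̂_i, …, X_k))
  - ∑_{i<j} (-1)^i (-1)^{s_i (s_{i+1} + ⋯ + s_j)} η(X₀, …, X̂_i, …, [X_i, X_j], …, X_k)`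
with the bracket in the place of `X_j`, extended to all vector fields by summing over homogeneous
components. -/
def extDerivative {k : ℕ} (η : M.Cochain U k) : M.Cochain U (k + 1) := fun V X =>
  ∑ s : Fin (k + 1) → ZMod 2, ∑ i : Fin (k + 1), (-1 : ℝ) ^ (i : ℕ) •
    (koszulSign (s i * ∑ l ∈ Finset.Ioi i, s l) •
        ((X i).part (s i)).app (η V (i.removeNth fun l => (X l).part (s l))) -
      ∑ j ∈ Finset.Ioi i, koszulSign (s i * ∑ l ∈ Finset.Ioc i j, s l) •
        η V (i.removeNth (Function.update (fun l => (X l).part (s l)) j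
          ⁅(X i).part (s i), (X j).part (s j)⁆)))

/-- The characteristic set `ker α ∩ ker dα` of a form `α` on `M`, as the assignment to each open
set `U` of the set of vector fields `X` on `U` with `i_X α = 0` and `i_X dα = 0`. -/
def characteristicSet {k : ℕ} (α : M.Cochain ⊤ k) (U : Opens M.body) : Set (M.Vec U) :=
  {X | interior X (α.restrict le_top) = 0 ∧ interior X ((extDerivative α).restrict le_top) = 0}

/-- `D` is a distribution of rank `r`, i.e. (the sheaf of sections of) a vector subbundle of rank `r`
of the tangent bundle: near every point there is a frame of the tangent bundle, consisting of
homogeneous vector fields, whose first `r` members freely generate `D`. -/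
def IsDistribution (D : ∀ U : Opens M.body, Set (M.Vec U)) (r : ℕ) : Prop :=
  ∀ x : M.body, ∃ U : Opens M.body, x ∈ U ∧ ∃ (m : ℕ) (e : Fin r ⊕ Fin m → M.Vec U),
    (∀ i, ∃ a, (e i).IsHom a) ∧
    ∀ (V : Opens M.body) (h : V ≤ U),
      LinearIndependent (M.Fn V) (fun i => (e i).restrict h) ∧
      Submodule.span (M.Fn V) (Set.range fun i => (e i).restrict h) = ⊤ ∧
      D V = Submodule.span (M.Fn V) (Set.range fun i => (e (Sum.inl i)).restrict h)

/-- `D` is closed under the super Lie bracket. -/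
def IsInvolutive (D : ∀ U : Opens M.body, Set (M.Vec U)) : Prop :=
  ∀ (U : Opens M.body) (X Y : M.Vec U), X ∈ D U → Y ∈ D U → ⁅X, Y⁆ ∈ D U

/-- A form is regular if its characteristic set is a distribution of some rank. -/
def IsRegular {k : ℕ} (α : M.Cochain ⊤ k) : Prop :=
  ∃ r : ℕ, IsDistribution (characteristicSet α) r

end Supermanifold

end

/-!
Cartan's formulas `i_X d + d i_X = L_X`, `i_[X,Y] = [L_X, i_Y]` and `L_[X,Y] = [L_X, L_Y]` (graded
commutators, `X` and `Y` homogeneous) hold for every cochain that is additive in each argument.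
By the first one, `χ(α)` consists of the `X` with `i_X α = 0` and `L_X α = 0`, which is the
invariance of `α`; by the other two it is closed under brackets of homogeneous members.
Regularity enters only through the local frames of homogeneous fields: with the sheaf property they
show that `χ(α)` contains the homogeneous components of its members.
-/

namespace Supermanifold

variable {p q : ℕ} {M : Supermanifold.{u} p q} {U V : Opens M.body}

theorem koszulSign_zero : koszulSign 0 = 1 := by
  simp [koszulSign]

theorem koszulSign_mul_self (a : ZMod 2) : koszulSign a * koszulSign a = 1 := by
  rw [← koszulSign_add, CharTwo.add_self_eq_zero, koszulSign_zero]

theorem koszulSign_eq_one_or_neg_one (a : ZMod 2) : koszulSign a = 1 ∨ koszulSign a = -1 :=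
  neg_one_pow_eq_or ℝ _

theorem fn_eq_of_locally_eq {f g : M.Fn U}
    (H : ∀ x ∈ U, ∃ V, ∃ h : V ≤ U, x ∈ V ∧ M.res h f = M.res h g) : f = g := by
  choose! V hVU hxV hfg using H
  exact TopCat.Sheaf.eq_of_locally_eq' M.structureSheaf (fun x : U => V x) U
    (fun x => homOfLE (hVU x x.2)) (fun x hx => Opens.mem_iSup.2 ⟨⟨x, hx⟩, hxV x hx⟩) f g
    fun x => hfg x x.2

namespace Vec

theorem sum_part (X : M.Vec U) : ∑ a, X.part a = X :=
  Finset.univ_sum_single X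

theorem isHom_iff {X : M.Vec U} {a : ZMod 2} : X.IsHom a ↔ ∀ b ≠ a, X b = 0 := by
  refine ⟨fun hX b hb => ?_, fun hX => funext fun b => ?_⟩
  · rw [hX, part, of, Pi.single_eq_of_ne hb]
  · by_cases hb : b = a
    · subst hb
      rw [part, of, Pi.single_eq_same]
    · rw [part, of, Pi.single_eq_of_ne hb, hX b hb]

theorem isHom_part (X : M.Vec U) (a : ZMod 2) : (X.part a).IsHom a :=
  isHom_iff.2 fun _ hb => Pi.single_eq_of_ne hb _

theorem IsHom.part_of_ne {X : M.Vec U} {a b : ZMod 2} (hX : X.IsHom a) (h : b ≠ a) :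
    X.part b = 0 := by
  rw [part, of, isHom_iff.1 hX b h, Pi.single_zero]

theorem IsHom.oper_eq {X : M.Vec U} {a : ZMod 2} (hX : X.IsHom a) : X.oper = X a :=
  Fintype.sum_eq_single a fun b hb => by rw [isHom_iff.1 hX b hb, ZeroMemClass.coe_zero]

/-- The component of parity `a` as an additive map. -/
def partHom (a : ZMod 2) : M.Vec U →+ M.Vec U where
  toFun X := X.part a
  map_zero' := Pi.single_zero a
  map_add' _ _ := Pi.single_add _ _ _

theorem partHom_apply (a : ZMod 2) (X : M.Vec U) : partHom a X = X.part a := rfl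

theorem part_smul (f : M.Fn U) (X : M.Vec U) (a : ZMod 2) :
    (f • X).part a = ∑ b, GradedRing.proj (M.parity U) (a - b) f • X.part b := by
  apply operHom_injective U
  rw [map_sum]
  change ((f • X).part a).oper = ∑ b, (GradedRing.proj (M.parity U) (a - b) f • X.part b).oper
  rw [(isHom_part _ a).oper_eq]
  simp only [oper_smul, (isHom_part _ _).oper_eq]
  simp only [part, of, Pi.single_eq_same]
  rfl

theorem part_mem_span {ι : Type*} {e : ι → M.Vec U} (he : ∀ i, ∃ a, (e i).IsHom a) {X : M.Vec U}
    (hX : X ∈ Submodule.span (M.Fn U) (Set.range e)) (a : ZMod 2) :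
    X.part a ∈ Submodule.span (M.Fn U) (Set.range e) := by
  induction hX using Submodule.span_induction generalizing a with
  | mem Y hY =>
    obtain ⟨i, rfl⟩ := hY
    obtain ⟨b, hb⟩ := he i
    by_cases hab : a = b
    · subst hab
      rw [← hb]
      exact Submodule.subset_span ⟨i, rfl⟩
    · rw [hb.part_of_ne hab]
      exact zero_mem _
  | zero =>
    rw [← partHom_apply, map_zero]
    exact zero_mem _
  | add Y Z _ _ hY hZ =>
    rw [← partHom_apply, map_add]
    exact add_mem (hY a) (hZ a)
  | smul f Y _ hY =>
    rw [part_smul]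
    exact Submodule.sum_mem _ fun b _ => Submodule.smul_mem _ _ (hY b)

/-- The action of vector fields on superfunctions as a biadditive map. -/
def appHom : M.Vec U →+ M.Fn U →+ M.Fn U :=
  AddMonoidHom.mk' (fun X => (X.oper ⟨U, le_rfl⟩).toAddMonoidHom) fun X Y => by
    ext f
    exact congrArg (fun D : M.Oper U => D ⟨U, le_rfl⟩ f) (map_add (operHom U) X Y)

theorem appHom_apply (X : M.Vec U) (f : M.Fn U) : appHom X f = X.app f := rfl

theorem app_smul (X : M.Vec U) (c : ℝ) (f : M.Fn U) : X.app (c • f) = c • X.app f :=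
  map_smul (X.oper ⟨U, le_rfl⟩) c f

theorem res_app (h : V ≤ U) (X : M.Vec U) (f : M.Fn U) :
    M.res h (X.app f) = (X.restrict h).app (M.res h f) := by
  have hX : ∀ a, M.res h ((X a : M.Oper U) ⟨U, le_rfl⟩ f) =
      (X a : M.Oper U) ⟨V, h⟩ (M.res h f) := fun a => (X a).2.1 ⟨U, le_rfl⟩ ⟨V, h⟩ h f
  simp [app, oper, Finset.sum_apply, hX, Vec.restrict]

theorem coe_bracket_apply (X Y : M.Vec U) (c : ZMod 2) : (⁅X, Y⁆ c : M.Oper U) =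
    ∑ a, ((X a : M.Oper U) * (Y (c - a) : M.Oper U) -
      koszulSign (a * (c - a)) • ((Y (c - a) : M.Oper U) * (X a : M.Oper U))) := rfl

theorem bracket_add (X Y Z : M.Vec U) : ⁅X, Y + Z⁆ = ⁅X, Y⁆ + ⁅X, Z⁆ := by
  funext c
  refine Subtype.ext ?_
  simp only [coe_bracket_apply, Pi.add_apply, Submodule.coe_add, mul_add, add_mul, smul_add,
    add_sub_add_comm, Finset.sum_add_distrib]

theorem add_bracket (X Y Z : M.Vec U) : ⁅X + Y, Z⁆ = ⁅X, Z⁆ + ⁅Y, Z⁆ := by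
  funext c
  refine Subtype.ext ?_
  simp only [coe_bracket_apply, Pi.add_apply, Submodule.coe_add, mul_add, add_mul, smul_add,
    add_sub_add_comm, Finset.sum_add_distrib]

theorem bracket_zero (X : M.Vec U) : ⁅X, (0 : M.Vec U)⁆ = 0 := by
  funext c
  refine Subtype.ext ?_
  simp [coe_bracket_apply]

theorem zero_bracket (X : M.Vec U) : ⁅(0 : M.Vec U), X⁆ = 0 := by
  funext c
  refine Subtype.ext ?_
  simp [coe_bracket_apply]

/-- The super Lie bracket as a biadditive map. -/
def bracketHom : M.Vec U →+ M.Vec U →+ M.Vec U where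
  toFun X := { toFun := fun Y => ⁅X, Y⁆, map_zero' := bracket_zero X, map_add' := bracket_add X }
  map_zero' := AddMonoidHom.ext zero_bracket
  map_add' X Y := AddMonoidHom.ext (add_bracket X Y)

theorem bracketHom_apply (X Y : M.Vec U) : bracketHom X Y = ⁅X, Y⁆ := rfl

theorem bracket_eq_sum_part (X Y : M.Vec U) : ⁅X, Y⁆ = ∑ a, ∑ b, ⁅X.part a, Y.part b⁆ := by
  conv_lhs => rw [← sum_part X, ← sum_part Y, ← bracketHom_apply]
  simp only [map_sum, AddMonoidHom.finsetSum_apply, bracketHom_apply]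
  exact Finset.sum_comm

theorem IsHom.bracket {X Y : M.Vec U} {a b : ZMod 2} (hX : X.IsHom a) (hY : Y.IsHom b) :
    ⁅X, Y⁆.IsHom (a + b) := by
  refine isHom_iff.2 fun c hc => Subtype.ext ?_
  rw [coe_bracket_apply, Fintype.sum_eq_single a, isHom_iff.1 hY (c - a)]
  · simp
  · rintro rfl
    exact hc (add_sub_cancel a c).symm
  · intro d hd
    simp [isHom_iff.1 hX d hd]

theorem oper_bracket_of_isHom {X Y : M.Vec U} {a b : ZMod 2} (hX : X.IsHom a) (hY : Y.IsHom b) :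
    ⁅X, Y⁆.oper = X.oper * Y.oper - koszulSign (a * b) • (Y.oper * X.oper) := by
  rw [(hX.bracket hY).oper_eq, coe_bracket_apply, Fintype.sum_eq_single a, add_sub_cancel_left,
    hX.oper_eq, hY.oper_eq]
  intro c hc
  simp [isHom_iff.1 hX c hc]

theorem bracket_app_of_isHom {X Y : M.Vec U} {a b : ZMod 2} (hX : X.IsHom a) (hY : Y.IsHom b)
    (f : M.Fn U) :
    ⁅X, Y⁆.app f = X.app (Y.app f) - koszulSign (a * b) • Y.app (X.app f) := by
  rw [app, oper_bracket_of_isHom hX hY]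
  rfl

theorem leibniz_bracket_of_isHom {X Y Z : M.Vec U} {a b c : ZMod 2} (hX : X.IsHom a)
    (hY : Y.IsHom b) (hZ : Z.IsHom c) :
    ⁅X, ⁅Y, Z⁆⁆ = ⁅⁅X, Y⁆, Z⁆ + koszulSign (a * b) • ⁅Y, ⁅X, Z⁆⁆ := by
  apply operHom_injective U
  rw [map_add]
  change ⁅X, ⁅Y, Z⁆⁆.oper = ⁅⁅X, Y⁆, Z⁆.oper + (koszulSign (a * b) • ⁅Y, ⁅X, Z⁆⁆).oper
  have oper_smul (r : ℝ) (W : M.Vec U) : (r • W).oper = r • W.oper := by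
    simp [oper, Finset.smul_sum]
  rw [oper_smul, oper_bracket_of_isHom (hX.bracket hY) hZ,
    oper_bracket_of_isHom hX (hY.bracket hZ), oper_bracket_of_isHom hY (hX.bracket hZ),
    oper_bracket_of_isHom hX hY, oper_bracket_of_isHom hX hZ, oper_bracket_of_isHom hY hZ]
  have sign_sq (x : ℝ) : koszulSign (a * b) * (koszulSign (a * b) * x) = x := by
    rw [← mul_assoc, koszulSign_mul_self, one_mul]
  simp only [mul_add, add_mul, koszulSign_add, mul_sub, sub_mul, smul_sub, smul_smul,
    mul_smul_comm, smul_mul_assoc, mul_assoc, mul_comm b a, sign_sq]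
  module

theorem restrict_part (h : V ≤ U) (X : M.Vec U) (a : ZMod 2) :
    (X.part a).restrict h = (X.restrict h).part a := by
  funext b
  by_cases hb : b = a
  · subst hb
    simp [part, of, restrict]
  · simp only [part, of, restrict, Pi.single_eq_of_ne hb]
    rfl

theorem restrict_bracket (h : V ≤ U) (X Y : M.Vec U) :
    ⁅X, Y⁆.restrict h = ⁅X.restrict h, Y.restrict h⁆ := by
  funext c
  refine Subtype.ext (funext fun W => ?_)
  simp [restrict, Bracket.bracket]

theorem IsHom.restrict {X : M.Vec U} {a : ZMod 2} (hX : X.IsHom a) (h : V ≤ U) :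
    (X.restrict h).IsHom a := by
  rw [IsHom, ← restrict_part, ← hX]

end Vec

open Function

variable {k : ℕ}

/-- Additivity in each argument, which is all that the Cartan calculus below requires of a
differential form. -/
def IsMultiAdditive (f : (Fin k → M.Vec U) → M.Fn U) : Prop :=
  ∀ (Z : Fin k → M.Vec U) (i : Fin k) (X Y : M.Vec U),
    f (update Z i (X + Y)) = f (update Z i X) + f (update Z i Y)

namespace IsMultiAdditive

section

variable {f g : (Fin k → M.Vec U) → M.Fn U}

/-- A multiadditive function as an additive function of its `i`-th argument. -/
def slotHom (hf : IsMultiAdditive f) (Z : Fin k → M.Vec U) (i : Fin k) : M.Vec U →+ M.Fn U where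
  toFun X := f (update Z i X)
  map_zero' := by simpa using hf Z i 0 0
  map_add' := hf Z i

theorem slotHom_apply (hf : IsMultiAdditive f) (Z : Fin k → M.Vec U) (i : Fin k) (X : M.Vec U) :
    hf.slotHom Z i X = f (update Z i X) := rfl

theorem map_update_zero (hf : IsMultiAdditive f) (Z : Fin k → M.Vec U) (i : Fin k) :
    f (update Z i 0) = 0 :=
  map_zero (hf.slotHom Z i)

theorem map_coord_zero (hf : IsMultiAdditive f) {Z : Fin k → M.Vec U} (i : Fin k)
    (hi : Z i = 0) : f Z = 0 := by
  rw [← update_eq_self i Z, hi, hf.map_update_zero]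

theorem map_update_koszulSign_smul (hf : IsMultiAdditive f) (Z : Fin k → M.Vec U) (i : Fin k)
    (a : ZMod 2) (X : M.Vec U) :
    f (update Z i (koszulSign a • X)) = koszulSign a • f (update Z i X) := by
  have neg_one_smul_add_self : (-1 : ℝ) • X + X = 0 := funext fun b =>
    (congrArg (· + X b) (neg_one_smul ℝ (X b))).trans (neg_add_cancel (X b))
  rcases koszulSign_eq_one_or_neg_one a with h | h
  · rw [h, one_smul, one_smul]
  · rw [h, neg_one_smul ℝ (f _), eq_neg_iff_add_eq_zero, ← hf, neg_one_smul_add_self,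
      hf.map_update_zero]

/-- A multiadditive function as an `ℕ`-multilinear map. -/
def toMultilinearMap (hf : IsMultiAdditive f) :
    MultilinearMap ℕ (fun _ : Fin k => M.Vec U) (M.Fn U) where
  toFun := f
  map_update_add' {inst} Z i X Y := by
    rw [Subsingleton.elim inst (instDecidableEqFin k)]
    exact hf Z i X Y
  map_update_smul' {inst} Z i n X := by
    rw [Subsingleton.elim inst (instDecidableEqFin k)]
    exact map_nsmul (hf.slotHom Z i) n X

theorem apply_eq_sum_part (hf : IsMultiAdditive f) (Z : Fin k → M.Vec U) :
    f Z = ∑ s : Fin k → ZMod 2, f fun i => (Z i).part (s i) := by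
  have expand := hf.toMultilinearMap.map_sum fun i (a : ZMod 2) => (Z i).part a
  simp only [Vec.sum_part] at expand
  exact expand

theorem smul (hf : IsMultiAdditive f) (c : ℝ) : IsMultiAdditive (c • f) := by
  intro Z i X Y
  simp only [Pi.smul_apply, hf Z i X Y, smul_add]

theorem sub (hf : IsMultiAdditive f) (hg : IsMultiAdditive g) : IsMultiAdditive (f - g) := by
  intro Z i X Y
  simp only [Pi.sub_apply, hf Z i X Y, hg Z i X Y, add_sub_add_comm]

theorem sum {ι : Type*} [Fintype ι] {F : ι → (Fin k → M.Vec U) → M.Fn U}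
    (hF : ∀ j, IsMultiAdditive (F j)) : IsMultiAdditive (∑ j, F j) := by
  intro Z i X Y
  simp only [Finset.sum_apply, hF _ Z i X Y, Finset.sum_add_distrib]

theorem app_comp (hf : IsMultiAdditive f) (X : M.Vec U) :
    IsMultiAdditive fun Z => X.app (f Z) := by
  intro Z i Y Y'
  simp only [hf Z i Y Y', ← Vec.appHom_apply, map_add]

theorem comp_map_update (hf : IsMultiAdditive f) (φ : M.Vec U →+ M.Vec U) (j : Fin k) :
    IsMultiAdditive fun Z => f (update Z j (φ (Z j))) := by
  intro Z i X Y
  dsimp only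
  rcases eq_or_ne i j with rfl | hij
  · simp only [update_self, update_idem, map_add, hf Z i]
  · simp only [update_of_ne hij.symm, update_comm hij, hf (update Z j _) i]

theorem comp_map (hf : IsMultiAdditive f) (φ : Fin k → M.Vec U →+ M.Vec U) :
    IsMultiAdditive fun Z => f fun i => φ i (Z i) := by
  intro Z i X Y
  have map_update (W : M.Vec U) : (fun l => φ l (update Z i W l)) =
      update (fun l => φ l (Z l)) i (φ i W) :=
    funext fun l => apply_update (fun l => φ l) Z i W l
  simp only [map_update, map_add, hf _ i]

end

theorem curryLeft {f : (Fin (k + 1) → M.Vec U) → M.Fn U} (hf : IsMultiAdditive f) (X : M.Vec U) :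
    IsMultiAdditive fun Z => f (Fin.cons X Z) := by
  intro Z i Y Y'
  simp only [Fin.cons_update, hf _ i.succ Y Y']

theorem map_cons_add {f : (Fin (k + 1) → M.Vec U) → M.Fn U} (hf : IsMultiAdditive f)
    (X Y : M.Vec U) (Z : Fin k → M.Vec U) :
    f (Fin.cons (X + Y) Z) = f (Fin.cons X Z) + f (Fin.cons Y Z) := by
  have h := hf (Fin.cons 0 Z) 0 X Y
  simpa only [Fin.update_cons_zero] using h

theorem map_cons_eq_sum_part {f : (Fin (k + 1) → M.Vec U) → M.Fn U} (hf : IsMultiAdditive f)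
    (X : M.Vec U) (Z : Fin k → M.Vec U) :
    f (Fin.cons X Z) = ∑ a, f (Fin.cons (X.part a) Z) := by
  have h := map_sum (hf.slotHom (Fin.cons 0 Z) 0) X.part Finset.univ
  simpa only [Vec.sum_part, slotHom_apply, Fin.update_cons_zero] using h

end IsMultiAdditive

/-- Additivity of a cochain in each of its vector field arguments. -/
def Cochain.IsAdditive (η : M.Cochain U k) : Prop := ∀ V, IsMultiAdditive (η V)

theorem IsForm.isAdditive {η : M.Cochain U k} (hη : IsForm η) : η.IsAdditive := hη.map_add

theorem interior_zero (X : M.Vec U) : interior X (0 : M.Cochain U k) = 0 := by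
  cases k <;> rfl

/-- The Lie derivative along `X` of parity `a`, on arguments of parities `s`. -/
def lieTerm (f : (Fin k → M.Vec U) → M.Fn U) (a : ZMod 2) (s : Fin k → ZMod 2) (X : M.Vec U)
    (Z : Fin k → M.Vec U) : M.Fn U :=
  koszulSign (a * ∑ l, s l) • X.app (f Z) -
    ∑ j, koszulSign (a * ∑ l ∈ Finset.Iic j, s l) • f (update Z j ⁅X, Z j⁆)

namespace IsMultiAdditive

variable {f : (Fin k → M.Vec U) → M.Fn U}

theorem lieTerm (hf : IsMultiAdditive f) (a : ZMod 2) (s : Fin k → ZMod 2) (X : M.Vec U) :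
    IsMultiAdditive (lieTerm f a s X) := by
  convert ((hf.app_comp X).smul (koszulSign (a * ∑ l, s l))).sub
    (sum fun j => (hf.comp_map_update (Vec.bracketHom X) j).smul
      (koszulSign (a * ∑ l ∈ Finset.Iic j, s l))) using 1
  funext Z
  simp only [Supermanifold.lieTerm, Pi.sub_apply, Pi.smul_apply, Finset.sum_apply,
    Vec.bracketHom_apply]

end IsMultiAdditive

theorem lieTerm_add {f : (Fin k → M.Vec U) → M.Fn U} (hf : IsMultiAdditive f) (a : ZMod 2)
    (s : Fin k → ZMod 2) (X Y : M.Vec U) :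
    lieTerm f a s (X + Y) = lieTerm f a s X + lieTerm f a s Y := by
  funext Z
  simp only [Pi.add_apply, lieTerm, Vec.add_bracket, hf Z, smul_add, Finset.sum_add_distrib,
    ← Vec.appHom_apply, map_add, AddMonoidHom.add_apply]
  abel

theorem lieTerm_zero {f : (Fin k → M.Vec U) → M.Fn U} (hf : IsMultiAdditive f) (a : ZMod 2)
    (s : Fin k → ZMod 2) : lieTerm f a s 0 = 0 := by
  simpa using lieTerm_add hf a s 0 0

theorem lieDerivative_apply (X : M.Vec U) (η : M.Cochain U k) (V : {V // V ≤ U})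
    (Z : Fin k → M.Vec V.1) : lieDerivative X η V Z = ∑ a, ∑ s : Fin k → ZMod 2,
      lieTerm (η V) a s ((X.restrict V.2).part a) fun i => (Z i).part (s i) := rfl

namespace Cochain.IsAdditive

variable {η θ : M.Cochain U k}

theorem ext_of_isHom (hη : η.IsAdditive) (hθ : θ.IsAdditive)
    (H : ∀ V (s : Fin k → ZMod 2) Z, (∀ i, (Z i).IsHom (s i)) → η V Z = θ V Z) : η = θ := by
  funext V Z
  rw [(hη V).apply_eq_sum_part, (hθ V).apply_eq_sum_part]
  exact Finset.sum_congr rfl fun s _ => H V s _ fun i => Vec.isHom_part _ _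

theorem smul (hη : η.IsAdditive) (c : ℝ) : (c • η).IsAdditive := fun V => (hη V).smul c

theorem sub (hη : η.IsAdditive) (hθ : θ.IsAdditive) : (η - θ).IsAdditive :=
  fun V => (hη V).sub (hθ V)

theorem restrict (hη : η.IsAdditive) (h : V ≤ U) : (η.restrict h).IsAdditive :=
  fun W => hη ⟨W.1, W.2.trans h⟩

theorem interior (hη : η.IsAdditive) (X : M.Vec U) : (interior X η).IsAdditive := by
  cases k with
  | zero => exact fun _ _ i => i.elim0
  | succ k => exact fun V => (hη V).curryLeft (X.restrict V.2)

theorem lieDerivative (hη : η.IsAdditive) (X : M.Vec U) : (lieDerivative X η).IsAdditive := by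
  intro V
  convert IsMultiAdditive.sum fun a => IsMultiAdditive.sum fun s : Fin k → ZMod 2 =>
    ((hη V).lieTerm a s ((X.restrict V.2).part a)).comp_map fun i => Vec.partHom (s i) using 1
  funext Z
  simp only [Finset.sum_apply]
  rfl

end Cochain.IsAdditive

theorem interior_add {η : M.Cochain U k} (hη : η.IsAdditive) (X Y : M.Vec U) :
    interior (X + Y) η = interior X η + interior Y η := by
  cases k with
  | zero => exact (add_zero 0).symm
  | succ k => exact funext fun V => funext ((hη V).map_cons_add (X.restrict V.2) (Y.restrict V.2))

theorem lieDerivative_add {η : M.Cochain U k} (hη : η.IsAdditive) (X Y : M.Vec U) :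
    lieDerivative (X + Y) η = lieDerivative X η + lieDerivative Y η := by
  funext V Z
  have part_restrict_add (a : ZMod 2) : ((X + Y).restrict V.2).part a =
      (X.restrict V.2).part a + (Y.restrict V.2).part a :=
    map_add (Vec.partHom a) (X.restrict V.2) (Y.restrict V.2)
  simp only [Pi.add_apply, lieDerivative_apply, part_restrict_add, lieTerm_add (hη V),
    Finset.sum_add_distrib]

theorem lieDerivative_apply_of_isHom {η : M.Cochain U k} (hη : η.IsAdditive) {X : M.Vec U}
    {a : ZMod 2} (hX : X.IsHom a) (V : {V // V ≤ U}) {s : Fin k → ZMod 2} {Z : Fin k → M.Vec V.1}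
    (hZ : ∀ i, (Z i).IsHom (s i)) :
    lieDerivative X η V Z = lieTerm (η V) a s (X.restrict V.2) Z := by
  have hXV := hX.restrict V.2
  rw [lieDerivative_apply, Fintype.sum_eq_single a, Fintype.sum_eq_single s, ← hXV]
  · exact congrArg _ (funext fun i => (hZ i).symm)
  · intro t ht
    obtain ⟨i, hi⟩ := Function.ne_iff.1 ht
    exact ((hη V).lieTerm _ _ _).map_coord_zero i ((hZ i).part_of_ne hi)
  · intro b hb
    simp only [hXV.part_of_ne hb, lieTerm_zero (hη V), Pi.zero_apply, Finset.sum_const_zero]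

theorem lieDerivative_zero (X : M.Vec U) : lieDerivative X (0 : M.Cochain U k) = 0 := by
  funext V Z
  simp [lieDerivative, ← Vec.appHom_apply]

theorem sum_fin_cons {A N : Type*} [Fintype A] [AddCommMonoid N] (F : (Fin (k + 1) → A) → N) :
    ∑ s, F s = ∑ a, ∑ s : Fin k → A, F (Fin.cons a s) := by
  rw [← Fintype.sum_prod_type']
  exact (Equiv.sum_comp (Fin.consEquiv fun _ => A) F).symm

theorem removeNth_succ_cons {A : Type*} (x : A) (Z : Fin (k + 1) → A) (i : Fin (k + 1)) :
    i.succ.removeNth (Fin.cons x Z : Fin (k + 2) → A) =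
      (Fin.cons x (i.removeNth Z) : Fin (k + 1) → A) := by
  funext l
  refine Fin.cases ?_ (fun l => ?_) l
  · rw [Fin.removeNth_apply, Fin.succ_succAbove_zero, Fin.cons_zero, Fin.cons_zero]
  · rw [Fin.removeNth_apply, Fin.succ_succAbove_succ, Fin.cons_succ, Fin.cons_succ,
      Fin.removeNth_apply]

/-- The part of `(dη)(Y₀, …, Y_k)` in which `Y_i` is the acting vector field, for arguments `Y` of
parities `s`, without the sign `(-1)^i`. -/
def extTerm (f : (Fin k → M.Vec U) → M.Fn U) (s : Fin (k + 1) → ZMod 2)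
    (Y : Fin (k + 1) → M.Vec U) (i : Fin (k + 1)) : M.Fn U :=
  koszulSign (s i * ∑ l ∈ Finset.Ioi i, s l) • (Y i).app (f (i.removeNth Y)) -
    ∑ j ∈ Finset.Ioi i, koszulSign (s i * ∑ l ∈ Finset.Ioc i j, s l) •
      f (i.removeNth (update Y j ⁅Y i, Y j⁆))

theorem extDerivative_apply (η : M.Cochain U k) (V : {V // V ≤ U}) (Y : Fin (k + 1) → M.Vec V.1) :
    extDerivative η V Y = ∑ s : Fin (k + 1) → ZMod 2, ∑ i : Fin (k + 1), (-1 : ℝ) ^ (i : ℕ) •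
      extTerm (η V) s (fun l => (Y l).part (s l)) i := rfl

theorem extTerm_cons_zero (f : (Fin k → M.Vec U) → M.Fn U) (a : ZMod 2) (s : Fin k → ZMod 2)
    (X : M.Vec U) (Z : Fin k → M.Vec U) :
    extTerm f (Fin.cons a s) (Fin.cons X Z) 0 = lieTerm f a s X Z := by
  simp only [extTerm, lieTerm, Fin.removeNth_zero, Fin.cons_zero, Fin.Ioi_zero_eq_map,
    Finset.sum_map, Fin.coe_succEmb, Fin.cons_succ, ← Fin.map_succEmb_Iic, ← Fin.cons_update,
    Fin.tail_cons]

theorem extTerm_cons_succ (f : (Fin (k + 1) → M.Vec U) → M.Fn U) (a : ZMod 2)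
    (s : Fin (k + 1) → ZMod 2) (X : M.Vec U) (Z : Fin (k + 1) → M.Vec U) (i : Fin (k + 1)) :
    extTerm f (Fin.cons a s) (Fin.cons X Z) i.succ = extTerm (fun W => f (Fin.cons X W)) s Z i := by
  simp only [extTerm, Fin.cons_succ, ← Fin.map_succEmb_Ioi, ← Fin.map_succEmb_Ioc,
    Finset.sum_map, Fin.coe_succEmb, ← Fin.cons_update, removeNth_succ_cons]

theorem extTerm_sum {ι : Type*} (t : Finset ι) (F : ι → (Fin k → M.Vec U) → M.Fn U)
    (s : Fin (k + 1) → ZMod 2) (Y : Fin (k + 1) → M.Vec U) (i : Fin (k + 1)) :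
    extTerm (∑ a ∈ t, F a) s Y i = ∑ a ∈ t, extTerm (F a) s Y i := by
  simp only [extTerm, Finset.sum_apply, ← Vec.appHom_apply, map_sum, Finset.smul_sum,
    Finset.sum_sub_distrib]
  rw [Finset.sum_comm (s := t)]

theorem extDerivative_zero : extDerivative (0 : M.Cochain U k) = 0 := by
  funext V Y
  simp [extDerivative, ← Vec.appHom_apply]

theorem interior_extDerivative_apply (X : M.Vec U) (η : M.Cochain U k) (V : {V // V ≤ U})
    (Z : Fin k → M.Vec V.1) :
    interior X (extDerivative η) V Z = lieDerivative X η V Z +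
      ∑ a, ∑ s : Fin k → ZMod 2, ∑ i : Fin k, (-1 : ℝ) ^ (i.succ : ℕ) •
        extTerm (η V) (Fin.cons a s)
          (Fin.cons ((X.restrict V.2).part a) fun l => (Z l).part (s l)) i.succ := by
  have part_cons (a : ZMod 2) (s : Fin k → ZMod 2) :
      (fun l => (Fin.cons (X.restrict V.2) Z : Fin (k + 1) → M.Vec V.1) l |>.part
        ((Fin.cons a s : Fin (k + 1) → ZMod 2) l)) =
      Fin.cons ((X.restrict V.2).part a) fun l => (Z l).part (s l) :=
    funext fun l => Fin.cases rfl (fun _ => rfl) l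
  change extDerivative η V (Fin.cons (X.restrict V.2) Z) = _
  simp only [extDerivative_apply, sum_fin_cons, part_cons, Fin.sum_univ_succ (n := k),
    Fin.val_zero, pow_zero, one_smul, extTerm_cons_zero, Finset.sum_add_distrib,
    lieDerivative_apply]

theorem interior_extDerivative {η : M.Cochain U (k + 1)} (hη : η.IsAdditive) (X : M.Vec U) :
    interior X (extDerivative η) = lieDerivative X η - extDerivative (k := k) (interior X η) := by
  funext V Z
  have sum_cons_part : ∑ a, (fun W => η V (Fin.cons ((X.restrict V.2).part a) W)) =
      interior X η V := by
    funext W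
    rw [Finset.sum_apply]
    exact ((hη V).map_cons_eq_sum_part (X.restrict V.2) W).symm
  rw [interior_extDerivative_apply, Pi.sub_apply, Pi.sub_apply, sub_eq_add_neg,
    extDerivative_apply, ← Finset.sum_neg_distrib, Finset.sum_comm]
  congr 1
  refine Finset.sum_congr rfl fun s _ => ?_
  simp only [← Finset.sum_neg_distrib, ← sum_cons_part, extTerm_sum, extTerm_cons_succ,
    Fin.val_succ, pow_succ, mul_neg_one, neg_smul, Finset.smul_sum]
  exact Finset.sum_comm

theorem interior_extDerivative_of_interior_eq_zero {η : M.Cochain U k} (hη : η.IsAdditive)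
    {X : M.Vec U} (hX : interior X η = 0) :
    interior X (extDerivative η) = lieDerivative X η := by
  cases k with
  | zero =>
    funext V Z
    rw [interior_extDerivative_apply]
    simp
  | succ k =>
    rw [interior_extDerivative hη, hX]
    exact (congrArg _ extDerivative_zero).trans (sub_zero _)

theorem isHom_update {Z : Fin k → M.Vec U} {s : Fin k → ZMod 2} (hZ : ∀ i, (Z i).IsHom (s i))
    (j : Fin k) {X : M.Vec U} {a : ZMod 2} (hX : X.IsHom a) (i : Fin k) :
    (update Z j X i).IsHom (update s j a i) := by
  rcases eq_or_ne i j with rfl | hij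
  · simpa only [update_self] using hX
  · simpa only [update_of_ne hij] using hZ i

theorem isHom_cons {Z : Fin k → M.Vec U} {s : Fin k → ZMod 2} (hZ : ∀ i, (Z i).IsHom (s i))
    {X : M.Vec U} {a : ZMod 2} (hX : X.IsHom a) (i : Fin (k + 1)) :
    ((Fin.cons X Z : Fin (k + 1) → M.Vec U) i).IsHom ((Fin.cons a s : Fin (k + 1) → ZMod 2) i) :=
  Fin.cases hX hZ i

theorem sum_update_add {ι N : Type*} [DecidableEq ι] [AddCommMonoid N] (s : ι → N) (j : ι) (a : N)
    (A : Finset ι) :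
    ∑ l ∈ A, update s j (a + s j) l = (if j ∈ A then a else 0) + ∑ l ∈ A, s l := by
  have update_eq (l : ι) : update s j (a + s j) l = (if l = j then a else 0) + s l := by
    rcases eq_or_ne l j with rfl | hlj
    · simp
    · simp [hlj]
  simp [update_eq, Finset.sum_add_distrib]

theorem sum_Iic_succ_cons {N : Type*} [AddCommMonoid N] (a : N) (s : Fin k → N) (j : Fin k) :
    ∑ l ∈ Finset.Iic j.succ, (Fin.cons a s : Fin (k + 1) → N) l =
      a + ∑ l ∈ Finset.Iic j, s l := by
  rw [← Finset.Icc_bot, ← Finset.add_sum_Ioc_eq_sum_Icc bot_le, bot_eq_zero, Fin.cons_zero,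
    ← Fin.map_succEmb_Iic, Finset.sum_map]
  rfl

theorem lieTerm_cons (f : (Fin (k + 1) → M.Vec U) → M.Fn U) (a b : ZMod 2) (s : Fin k → ZMod 2)
    (X Y : M.Vec U) (Z : Fin k → M.Vec U) :
    lieTerm f a (Fin.cons b s) X (Fin.cons Y Z) =
      koszulSign (a * b) • (lieTerm (fun W => f (Fin.cons Y W)) a s X Z -
        f (Fin.cons ⁅X, Y⁆ Z)) := by
  simp only [lieTerm, Fin.sum_univ_succ, Fin.cons_zero, Fin.cons_succ, sum_Iic_succ_cons,
    Fin.update_cons_zero, ← Fin.cons_update, mul_add, koszulSign_add, mul_smul, smul_sub,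
    Finset.smul_sum]
  have Iic_zero : Finset.Iic (0 : Fin (k + 1)) = {0} := Finset.Iic_bot
  rw [Iic_zero, Finset.sum_singleton, Fin.cons_zero]
  abel

section LieTermLieTerm

variable (f : (Fin k → M.Vec U) → M.Fn U) (s : Fin k → ZMod 2) (Z : Fin k → M.Vec U)

/-- The terms of `L_X L_Y` or `L_Y L_X` in which `X` is bracketed with one of the arguments and `Y`
acts on the value, for `X` and `Y` of parities `a` and `b` and arguments of parities `s`. -/
def mixedTerm (a b : ZMod 2) (X Y : M.Vec U) : M.Fn U :=
  ∑ j, (koszulSign (a * ∑ l ∈ Finset.Iic j, s l) * koszulSign (b * ∑ l, s l)) •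
    Y.app (f (update Z j ⁅X, Z j⁆))

/-- The term of `L_X L_Y` in which `X` is bracketed with the `j`-th argument and then `Y` with
the `i`-th one, for `X` and `Y` of parities `a` and `b` and arguments of parities `s`. -/
def doubleBracketTerm (a b : ZMod 2) (X Y : M.Vec U) (j i : Fin k) : M.Fn U :=
  (koszulSign (a * ∑ l ∈ Finset.Iic j, s l) *
      koszulSign (b * ∑ l ∈ Finset.Iic i, update s j (a + s j) l)) •
    f (update (update Z j ⁅X, Z j⁆) i ⁅Y, update Z j ⁅X, Z j⁆ i⁆)

theorem doubleBracketTerm_swap (a b : ZMod 2) (X Y : M.Vec U) {j i : Fin k} (hij : i ≠ j) :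
    doubleBracketTerm f s Z a b X Y j i =
      koszulSign (a * b) • doubleBracketTerm f s Z b a Y X i j := by
  have arguments_swap : update (update Z j ⁅X, Z j⁆) i ⁅Y, update Z j ⁅X, Z j⁆ i⁆ =
      update (update Z i ⁅Y, Z i⁆) j ⁅X, update Z i ⁅Y, Z i⁆ j⁆ := by
    rw [update_of_ne hij, update_of_ne hij.symm, update_comm hij]
  rw [doubleBracketTerm, doubleBracketTerm, arguments_swap, smul_smul, sum_update_add,
    sum_update_add]
  have sign_sq := koszulSign_mul_self (a * b)
  rcases lt_or_gt_of_ne hij with hlt | hgt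
  · simp only [Finset.mem_Iic, hlt.le, hlt.not_ge, if_true, if_false, mul_add, koszulSign_add,
      mul_zero, koszulSign_zero]
    match_scalars
    linear_combination (-koszulSign (b * ∑ l ∈ Finset.Iic i, s l) *
      koszulSign (a * ∑ l ∈ Finset.Iic j, s l)) * sign_sq
  · simp only [Finset.mem_Iic, hgt.le, hgt.not_ge, if_true, if_false, mul_add, koszulSign_add,
      mul_comm b a, mul_zero, koszulSign_zero]
    match_scalars
    ring

variable {f s Z}

theorem doubleBracketTerm_self_sub (hf : IsMultiAdditive f) {a b : ZMod 2} {X Y : M.Vec U}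
    (hX : X.IsHom a) (hY : Y.IsHom b) {j : Fin k} (hZ : (Z j).IsHom (s j)) :
    doubleBracketTerm f s Z a b X Y j j - koszulSign (a * b) • doubleBracketTerm f s Z b a Y X j j =
      -(koszulSign ((a + b) * ∑ l ∈ Finset.Iic j, s l) • f (update Z j ⁅⁅X, Y⁆, Z j⁆)) := by
  have jacobi : f (update Z j ⁅X, ⁅Y, Z j⁆⁆) =
      f (update Z j ⁅⁅X, Y⁆, Z j⁆) + koszulSign (a * b) • f (update Z j ⁅Y, ⁅X, Z j⁆⁆) := by
    rw [Vec.leibniz_bracket_of_isHom hX hY hZ, hf, hf.map_update_koszulSign_smul]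
  simp only [doubleBracketTerm, sum_update_add, Finset.mem_Iic, le_refl, if_true, update_self,
    update_idem, jacobi, mul_add, add_mul, koszulSign_add, mul_comm b a]
  have sign_sq := koszulSign_mul_self (a * b)
  match_scalars
  · linear_combination (-koszulSign (b * ∑ l ∈ Finset.Iic j, s l) * koszulSign (a * b) *
      koszulSign (a * ∑ l ∈ Finset.Iic j, s l)) * sign_sq
  · linear_combination (-koszulSign (b * ∑ l ∈ Finset.Iic j, s l) *
      koszulSign (a * ∑ l ∈ Finset.Iic j, s l)) * sign_sq

theorem sum_doubleBracketTerm_sub (hf : IsMultiAdditive f) {a b : ZMod 2} {X Y : M.Vec U}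
    (hX : X.IsHom a) (hY : Y.IsHom b) (hZ : ∀ j, (Z j).IsHom (s j)) :
    ∑ j, ∑ i, doubleBracketTerm f s Z a b X Y j i -
        koszulSign (a * b) • ∑ j, ∑ i, doubleBracketTerm f s Z b a Y X j i =
      -∑ j, koszulSign ((a + b) * ∑ l ∈ Finset.Iic j, s l) • f (update Z j ⁅⁅X, Y⁆, Z j⁆) := by
  rw [Finset.sum_comm (f := doubleBracketTerm f s Z b a Y X), Finset.smul_sum,
    ← Finset.sum_sub_distrib, ← Finset.sum_neg_distrib]
  refine Finset.sum_congr rfl fun j _ => ?_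
  rw [Finset.smul_sum, ← Finset.sum_sub_distrib, Fintype.sum_eq_single j fun i hij => ?_]
  · exact doubleBracketTerm_self_sub hf hX hY (hZ j)
  · rw [doubleBracketTerm_swap f s Z a b X Y hij, sub_self]

end LieTermLieTerm

section Bracket

variable {η : M.Cochain U k} {X Y : M.Vec U} {a b : ZMod 2}

theorem interior_bracket (hη : η.IsAdditive) (hX : X.IsHom a) (hY : Y.IsHom b) :
    interior ⁅X, Y⁆ η = lieDerivative X (interior Y η) -
      koszulSign (a * b) • interior Y (lieDerivative X η) := by
  cases k with
  | zero =>
    rw [show interior Y η = 0 from rfl, lieDerivative_zero]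
    exact (sub_eq_zero_of_eq (smul_zero (koszulSign (a * b))).symm).symm
  | succ k =>
    refine (hη.interior _).ext_of_isHom (((hη.interior Y).lieDerivative X).sub
      (((hη.lieDerivative X).interior Y).smul _)) fun V s Z hZ => ?_
    rw [Pi.sub_apply, Pi.sub_apply, lieDerivative_apply_of_isHom (hη.interior Y) hX V hZ,
      Pi.smul_apply, Pi.smul_apply]
    change η V (Fin.cons (⁅X, Y⁆.restrict V.2) Z) = lieTerm _ a s _ Z -
      koszulSign (a * b) • lieDerivative X η V (Fin.cons (Y.restrict V.2) Z)
    rw [lieDerivative_apply_of_isHom hη hX V (isHom_cons hZ (hY.restrict V.2)), lieTerm_cons,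
      smul_smul, koszulSign_mul_self, one_smul, Vec.restrict_bracket]
    exact (sub_sub_cancel _ _).symm

theorem lieDerivative_lieDerivative_apply_of_isHom (hη : η.IsAdditive) (hX : X.IsHom a)
    (hY : Y.IsHom b) (V : {V // V ≤ U}) {s : Fin k → ZMod 2} {Z : Fin k → M.Vec V.1}
    (hZ : ∀ i, (Z i).IsHom (s i)) :
    lieDerivative X (lieDerivative Y η) V Z =
      (koszulSign (a * ∑ l, s l) * koszulSign (b * ∑ l, s l)) •
        (X.restrict V.2).app ((Y.restrict V.2).app (η V Z)) -
      mixedTerm (η V) s Z b a (Y.restrict V.2) (X.restrict V.2) -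
      koszulSign (a * b) • mixedTerm (η V) s Z a b (X.restrict V.2) (Y.restrict V.2) +
      ∑ j, ∑ i, doubleBracketTerm (η V) s Z a b (X.restrict V.2) (Y.restrict V.2) j i := by
  have bracket_isHom (j : Fin k) := isHom_update hZ j ((hX.restrict V.2).bracket (hZ j))
  rw [lieDerivative_apply_of_isHom (hη.lieDerivative Y) hX V hZ, lieTerm,
    lieDerivative_apply_of_isHom hη hY V hZ]
  simp only [lieDerivative_apply_of_isHom hη hY V (bracket_isHom _)]
  simp only [lieTerm, mixedTerm, doubleBracketTerm, sum_update_add, Finset.mem_univ, if_true,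
    ← Vec.appHom_apply, map_sub, map_sum]
  simp only [Vec.appHom_apply, Vec.app_smul, smul_sub, Finset.smul_sum, Finset.sum_sub_distrib,
    mul_add, koszulSign_add, smul_smul, mul_comm b a, mul_left_comm, mul_comm]
  abel

theorem lieDerivative_bracket (hη : η.IsAdditive) (hX : X.IsHom a) (hY : Y.IsHom b) :
    lieDerivative ⁅X, Y⁆ η = lieDerivative X (lieDerivative Y η) -
      koszulSign (a * b) • lieDerivative Y (lieDerivative X η) := by
  refine (hη.lieDerivative _).ext_of_isHom (((hη.lieDerivative Y).lieDerivative X).sub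
    (((hη.lieDerivative X).lieDerivative Y).smul _)) fun V s Z hZ => ?_
  rw [Pi.sub_apply, Pi.sub_apply, Pi.smul_apply, Pi.smul_apply,
    lieDerivative_apply_of_isHom hη (hX.bracket hY) V hZ,
    lieDerivative_lieDerivative_apply_of_isHom hη hX hY V hZ,
    lieDerivative_lieDerivative_apply_of_isHom hη hY hX V hZ, lieTerm, Vec.restrict_bracket,
    Vec.bracket_app_of_isHom (hX.restrict V.2) (hY.restrict V.2), mul_comm b a, add_mul,
    koszulSign_add]
  have double := sum_doubleBracketTerm_sub (hη V) (hX.restrict V.2) (hY.restrict V.2) hZ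
  have sign_sq := koszulSign_mul_self (a * b)
  -- The mixed terms cancel; the double brackets recombine by the Jacobi identity.
  linear_combination (norm := module)
    -sign_sq • mixedTerm (η V) s Z b a (Y.restrict V.2) (X.restrict V.2) - double

end Bracket

namespace Cochain

/-- Compatibility of a cochain with restriction to smaller open sets, so that its vanishing is a
local question. -/
def IsNatural (η : M.Cochain U k) : Prop :=
  ∀ (V W : {V // V ≤ U}) (h : W.1 ≤ V.1) (Z : Fin k → M.Vec V.1),
    M.res h (η V Z) = η W fun i => (Z i).restrict h

namespace IsNatural

variable {η : M.Cochain U k}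

theorem restrict (hη : η.IsNatural) (h : V ≤ U) : (η.restrict h).IsNatural :=
  fun W W' => hη ⟨W.1, W.2.trans h⟩ ⟨W'.1, W'.2.trans h⟩

theorem interior (hη : η.IsNatural) (X : M.Vec U) : (interior X η).IsNatural := by
  cases k with
  | zero => exact fun _ _ h _ => map_zero (M.res h)
  | succ k =>
    refine fun V W h Z => (hη V W h _).trans (congrArg (η W) ?_)
    exact funext fun i => Fin.cases rfl (fun _ => rfl) i

theorem extDerivative (hη : η.IsNatural) : (extDerivative η).IsNatural := by
  intro V W h Y
  have restrict_removeNth (Z : Fin (k + 1) → M.Vec V.1) (i : Fin (k + 1)) :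
      (fun l => (i.removeNth Z l).restrict h) = i.removeNth fun l => (Z l).restrict h := rfl
  have restrict_update (Z : Fin (k + 1) → M.Vec V.1) (j : Fin (k + 1)) (X : M.Vec V.1) :
      (fun l => (update Z j X l).restrict h) =
        update (fun l => (Z l).restrict h) j (X.restrict h) :=
    funext fun l => apply_update (fun _ => Vec.restrict h) Z j X l
  simp only [Supermanifold.extDerivative, map_sum, map_sub, map_smul, Vec.res_app, hη V W h,
    restrict_removeNth, restrict_update, Vec.restrict_part, Vec.restrict_bracket]

theorem eq_zero_of_locally (hη : η.IsNatural)
    (H : ∀ x ∈ U, ∃ V, ∃ h : V ≤ U, x ∈ V ∧ η.restrict h = 0) : η = 0 := by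
  funext W Z
  refine fn_eq_of_locally_eq fun x hx => ?_
  obtain ⟨V, hVU, hxV, hV⟩ := H x (W.2 hx)
  refine ⟨W.1 ⊓ V, inf_le_left, ⟨hx, hxV⟩, ?_⟩
  rw [hη W ⟨W.1 ⊓ V, inf_le_left.trans W.2⟩ inf_le_left, Pi.zero_apply, Pi.zero_apply, map_zero]
  exact congrFun (congrFun hV ⟨W.1 ⊓ V, inf_le_right⟩) _

end IsNatural

end Cochain

theorem interior_restrict (h : V ≤ U) (X : M.Vec U) (η : M.Cochain U k) :
    interior (X.restrict h) (η.restrict h) = (interior X η).restrict h := by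
  cases k <;> rfl

section CharacteristicSet

variable {α : M.Cochain ⊤ k} {X Y : M.Vec U} {a b : ZMod 2}

theorem restrict_mem_characteristicSet (hX : X ∈ characteristicSet α U) (h : V ≤ U) :
    X.restrict h ∈ characteristicSet α V :=
  ⟨(interior_restrict h X (α.restrict le_top)).trans (congrArg (Cochain.restrict h) hX.1),
    (interior_restrict h X ((extDerivative α).restrict le_top)).trans
      (congrArg (Cochain.restrict h) hX.2)⟩

theorem mem_characteristicSet_of_locally (hα : α.IsNatural)
    (H : ∀ x ∈ U, ∃ V, ∃ h : V ≤ U, x ∈ V ∧ X.restrict h ∈ characteristicSet α V) :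
    X ∈ characteristicSet α U := by
  constructor
  · refine ((hα.restrict le_top).interior X).eq_zero_of_locally fun x hx => ?_
    obtain ⟨V, h, hxV, hXV⟩ := H x hx
    exact ⟨V, h, hxV, (interior_restrict h X (α.restrict le_top)).symm.trans hXV.1⟩
  · refine ((hα.extDerivative.restrict le_top).interior X).eq_zero_of_locally fun x hx => ?_
    obtain ⟨V, h, hxV, hXV⟩ := H x hx
    exact ⟨V, h, hxV,
      (interior_restrict h X ((extDerivative α).restrict le_top)).symm.trans hXV.2⟩

theorem mem_characteristicSet_iff (hα : α.IsAdditive) : X ∈ characteristicSet α U ↔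
    interior X (α.restrict le_top) = 0 ∧ lieDerivative X (α.restrict le_top) = 0 := by
  refine and_congr_right fun hX => ?_
  rw [← interior_extDerivative_of_interior_eq_zero (hα.restrict le_top) hX]
  rfl

theorem bracket_mem_characteristicSet_of_isHom (hα : α.IsAdditive) (hX : X.IsHom a)
    (hY : Y.IsHom b) (hXα : X ∈ characteristicSet α U) (hYα : Y ∈ characteristicSet α U) :
    ⁅X, Y⁆ ∈ characteristicSet α U := by
  obtain ⟨-, lie_X⟩ := (mem_characteristicSet_iff hα).1 hXα
  obtain ⟨interior_Y, lie_Y⟩ := (mem_characteristicSet_iff hα).1 hYα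
  refine (mem_characteristicSet_iff hα).2 ⟨?_, ?_⟩
  · rw [interior_bracket (hα.restrict le_top) hX hY, interior_Y, lie_X, lieDerivative_zero,
      interior_zero, smul_zero, sub_zero]
  · rw [lieDerivative_bracket (hα.restrict le_top) hX hY, lie_X, lie_Y, lieDerivative_zero,
      lieDerivative_zero, smul_zero, sub_zero]

/-- The characteristic set on `U` of an additive cochain as an additive submonoid of the vector
fields on `U`. -/
def characteristicAddSubmonoid (hα : α.IsAdditive) (U : Opens M.body) :
    AddSubmonoid (M.Vec U) where
  carrier := characteristicSet α U
  zero_mem' := (mem_characteristicSet_iff hα).2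
    ⟨by simpa using interior_add (hα.restrict le_top) (0 : M.Vec U) 0,
      by simpa using lieDerivative_add (hα.restrict le_top) (0 : M.Vec U) 0⟩
  add_mem' {X Y} hX hY := by
    rw [mem_characteristicSet_iff hα] at hX hY ⊢
    rw [interior_add (hα.restrict le_top), lieDerivative_add (hα.restrict le_top), hX.1, hX.2,
      hY.1, hY.2]
    exact ⟨add_zero 0, add_zero 0⟩

end CharacteristicSet

/-- `D` contains the homogeneous components of its members. -/
def IsGraded (D : ∀ U : Opens M.body, Set (M.Vec U)) : Prop :=
  ∀ (U : Opens M.body) (X : M.Vec U), X ∈ D U → ∀ a, X.part a ∈ D U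

theorem IsRegular.isGraded {α : M.Cochain ⊤ k} (hreg : IsRegular α) (hα : α.IsNatural) :
    IsGraded (characteristicSet α) := by
  intro U X hX a
  obtain ⟨r, hr⟩ := hreg
  refine mem_characteristicSet_of_locally hα fun x hx => ?_
  obtain ⟨U', hxU', m, e, e_isHom, frame⟩ := hr x
  obtain ⟨-, -, span_eq⟩ := frame (U ⊓ U') inf_le_right
  refine ⟨U ⊓ U', inf_le_left, ⟨hx, hxU'⟩, ?_⟩
  have restrict_mem := restrict_mem_characteristicSet hX (inf_le_left : U ⊓ U' ≤ U)
  rw [span_eq] at restrict_mem ⊢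
  rw [Vec.restrict_part]
  exact Vec.part_mem_span (fun i => (e_isHom (Sum.inl i)).imp fun _ he => he.restrict inf_le_right)
    restrict_mem a

theorem isInvolutive_characteristicSet {α : M.Cochain ⊤ k} (hα : α.IsAdditive)
    (hgr : IsGraded (characteristicSet α)) : IsInvolutive (characteristicSet α) := by
  intro U X Y hX hY
  rw [Vec.bracket_eq_sum_part]
  exact (characteristicAddSubmonoid hα U).sum_mem fun a _ =>
    (characteristicAddSubmonoid hα U).sum_mem fun b _ =>
      bracket_mem_characteristicSet_of_isHom hα (X.isHom_part a) (Y.isHom_part b)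
        (hgr U X hX a) (hgr U Y hY b)

end Supermanifold

theorem mainTheorem5_general {p q : ℕ} (M : Supermanifold.{u} p q) {k : ℕ}
    (α : M.Cochain ⊤ k) (hα : α.IsAdditive)
    (hgr : Supermanifold.IsGraded (Supermanifold.characteristicSet α)) :
    Supermanifold.IsInvolutive (Supermanifold.characteristicSet α) ∧
      ∀ (U : TopologicalSpace.Opens M.body) (X : M.Vec U),
        X ∈ Supermanifold.characteristicSet α U →
          Supermanifold.lieDerivative X (α.restrict le_top) = 0 :=
  ⟨Supermanifold.isInvolutive_characteristicSet hα hgr,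
    fun _ _ hX => ((Supermanifold.mem_characteristicSet_iff hα).1 hX).2⟩

theorem mainTheorem5 {p q : ℕ} (M : Supermanifold.{u} p q) {k : ℕ}
    (α : M.Cochain ⊤ k) (hα : Supermanifold.IsForm α) (hreg : Supermanifold.IsRegular α) :
    Supermanifold.IsInvolutive (Supermanifold.characteristicSet α) ∧
      ∀ (U : TopologicalSpace.Opens M.body) (X : M.Vec U),
        X ∈ Supermanifold.characteristicSet α U →
          Supermanifold.lieDerivative X (α.restrict le_top) = 0 :=
  mainTheorem5_general M α hα.isAdditive (hreg.isGraded hα.natural)
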